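/- Let $\mu_1,\mu_2$ (source classes) and $\nu_1,\nu_2$ (target classes) be Borel probability measures on $\mathbb{R}^d$, and put $\mu=\tfrac12\mu_1+\tfrac12\mu_2$ and $\nu=\tfrac12\nu_1+\tfrac12\nu_2$, with $W_1(\nu,\mu)<\infty$. Let $\epsilon>0$, and suppose that there are bounded Borel sets $E_{\mu_1},E_{\mu_2},E_{\nu_1},E_{\nu_2}\subset\mathbb{R}^d$ with $E_{\mu_1}\cap E_{\mu_2}=\emptyset$ and $E_{\nu_1}\cap E_{\nu_2}=\emptyset$, such that $\mu_i(E_{\mu_i})\ge 1-\epsilon$ and $\nu_i(E_{\nu_i})\ge 1-\epsilon$ for $i=1,2$, and $$(r_{\mu_1}+r_{\nu_1}+l_1)+(r_{\mu_2}+r_{\nu_2}+l_2)<L_1+L_2,$$ where $r_{\mu_i}$ and $r_{\nu_i}$ are the diameters of $E_{\mu_i}$ and $E_{\nu_i}$, $l_i=d(E_{\mu_i},E_{\nu_i})$, $L_1=d(E_{\mu_1},E_{\nu_2})$, $L_2=d(E_{\mu_2},E_{\nu_1})$, and $d(A,B)=\inf\{\|a-b\|:a\in A,\ b\in B\}$.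 Let $h:\mathbb{R}^d\to\{1,2\}$ be a measurable classifier that correctly separates the source sets $E_{\mu_1}$ and $E_{\mu_2}$, that is, $h=i$ on $E_{\mu_i}$ for $i=1,2$. Let $T_\nu^\mu$ be an optimal transport map from $\nu$ to $\mu$ for the cost $\|x-y\|$, that is, a measurable map such that the plan $(\mathrm{id},T_\nu^\mu)_\#\nu$ is a coupling of $\nu$ and $\mu$ that minimizes $\int\|x-y\|\,d\gamma(x,y)$ over all couplings $\gamma$ of $\nu$ and $\mu$. Then target samples are correctly classified after optimal transportation with probability greater than $1-7\epsilon$: if the label $Y$ is uniform on $\{1,2\}$ and, given $Y=i$, the target sample $X$ has law $\nu_i$, then $$\mathbb{P}\bigl(h(T_\nu^\mu(X))=Y\bigr)>1-7\epsilon .$$ -/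

import Mathlib

open MeasureTheory
open scoped ENNReal

noncomputable section

/-- `d(A, B) = inf {‖a - b‖ : a ∈ A, b ∈ B}`, the distance between two sets. -/
def setDist {X : Type*} [PseudoMetricSpace X] (A B : Set X) : ℝ :=
  sInf (Set.image2 dist A B)

/-- The set `Γ(ν, μ)` of couplings: measures on the product with marginals `ν` and `μ`. -/
def IsCoupling {X : Type*} [MeasurableSpace X] (γ : Measure (X × X)) (ν μ : Measure X) : Prop :=
  γ.map Prod.fst = ν ∧ γ.map Prod.snd = μ

/-- The Kantorovich cost `∫ ‖x - y‖ dγ(x, y)` of a plan, with values in `[0, ∞]`. -/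
def transportCost {X : Type*} [PseudoMetricSpace X] [MeasurableSpace X]
    (γ : Measure (X × X)) : ℝ≥0∞ :=
  ∫⁻ z, edist z.1 z.2 ∂γ

/-- The Wasserstein-1 distance, with values in `[0, ∞]`. -/
def wasserstein1 {X : Type*} [PseudoMetricSpace X] [MeasurableSpace X]
    (ν μ : Measure X) : ℝ≥0∞ :=
  ⨅ (γ : Measure (X × X)) (_ : IsCoupling γ ν μ), transportCost γ

/-- `γ` is a minimizer of the Kantorovich problem between `ν` and `μ` for the cost `‖x - y‖`. -/
def IsOptimalPlan {X : Type*} [PseudoMetricSpace X] [MeasurableSpace X]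
    (γ : Measure (X × X)) (ν μ : Measure X) : Prop :=
  IsCoupling γ ν μ ∧ ∀ γ' : Measure (X × X), IsCoupling γ' ν μ →
    transportCost γ ≤ transportCost γ'

/-- `T` is an optimal transport map from `ν` to `μ`: the plan `(id, T)_# ν` induced by `T`
is an optimal plan (in particular `T_# ν = μ`). -/
def IsOptimalTransportMap {X : Type*} [PseudoMetricSpace X] [MeasurableSpace X]
    (T : X → X) (ν μ : Measure X) : Prop :=
  Measurable T ∧ IsOptimalPlan (ν.map fun x => (x, T x)) ν μ

/-- The balanced mixture of the two class measures: the law of an unlabelled sample. -/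
def balancedMixture {X : Type*} [MeasurableSpace X] (ρ : Fin 2 → Measure X) : Measure X :=
  (2⁻¹ : ℝ≥0∞) • ρ 0 + (2⁻¹ : ℝ≥0∞) • ρ 1

/-- The law of a labelled sample `(Y, X)`: the label `Y` is uniform on the two classes, and
given `Y = i` the point `X` has law `ρ i`. -/
def labelledLaw {X : Type*} [MeasurableSpace X] (ρ : Fin 2 → Measure X) :
    Measure (Fin 2 × X) :=
  (2⁻¹ : ℝ≥0∞) • (ρ 0).map (fun x => ((0 : Fin 2), x)) +
    (2⁻¹ : ℝ≥0∞) • (ρ 1).map (fun x => ((1 : Fin 2), x))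

end

/-! The core is cyclical monotonicity in quantitative form. If an optimal plan charged both
mismatched products `Eν 0 × Eμ 1` and `Eν 1 × Eμ 0`, exchanging targets between them would strictly
lower the cost, by the separation hypothesis; so one of the two is null
(`IsOptimalPlan.measure_prod_eq_zero_or`). The rest is mass counting. Say no mass goes from `Eν 0`
to `Eμ 1`: then `Eν 0` nearly fills the preimage of `Eμ 0`, whose mass is about one half, and at
most `2ε` is left for points of `Eν 1`. Adding `ε` for samples outside their class set and `ε` for
images outside both source sets gives error at most `4ε`, which is less than `7ε`. -/

open MeasureTheory
open scoped ENNReal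

/-! ### Exchange argument for optimal plans -/

section Optimality

variable {X : Type*} [PseudoMetricSpace X] [MeasurableSpace X]

lemma transportCost_add (γ γ' : Measure (X × X)) :
    transportCost (γ + γ') = transportCost γ + transportCost γ' :=
  lintegral_add_measure _ _ _

lemma transportCost_smul (c : ℝ≥0∞) (γ : Measure (X × X)) :
    transportCost (c • γ) = c * transportCost γ := by
  simp [transportCost, lintegral_smul_measure]

lemma ae_mem_prod_of_marginals {Y : Type*} [MeasurableSpace Y] {ρ σ : Measure Y} [SFinite ρ]
    [SFinite σ] {A B : Set Y} (hA : ∀ᵐ x ∂ρ, x ∈ A) (hB : ∀ᵐ y ∂σ, y ∈ B) :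
    ∀ᵐ z ∂(ρ.prod σ), z.1 ∈ A ∧ z.2 ∈ B := by
  filter_upwards [Measure.quasiMeasurePreserving_fst.ae hA,
    Measure.quasiMeasurePreserving_snd.ae hB] with z h1 h2 using ⟨h1, h2⟩

/-- If crossing the pairs in `A₀ × B₁` and `A₁ × B₀` strictly lowers the cost, an optimal plan of
finite cost charges at most one of these two products. -/
theorem IsOptimalPlan.measure_prod_eq_zero_or {γ : Measure (X × X)} [IsProbabilityMeasure γ]
    {ν μ : Measure X} (hγ : IsOptimalPlan γ ν μ) (hfin : transportCost γ ≠ ∞)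
    {A₀ A₁ B₀ B₁ : Set X} (hA₀ : MeasurableSet A₀) (hA₁ : MeasurableSet A₁)
    (hB₀ : MeasurableSet B₀) (hB₁ : MeasurableSet B₁) (hA : Disjoint A₀ A₁)
    {k₀ k₁ m₀ m₁ : ℝ≥0∞}
    (hk₀ : ∀ x ∈ A₀, ∀ y ∈ B₁, k₀ ≤ edist x y) (hk₁ : ∀ x ∈ A₁, ∀ y ∈ B₀, k₁ ≤ edist x y)
    (hm₀ : ∀ x ∈ A₀, ∀ y ∈ B₀, edist x y ≤ m₀) (hm₁ : ∀ x ∈ A₁, ∀ y ∈ B₁, edist x y ≤ m₁)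
    (hlt : m₀ + m₁ < k₀ + k₁) :
    γ (A₀ ×ˢ B₁) = 0 ∨ γ (A₁ ×ˢ B₀) = 0 := by
  by_contra! hpos
  obtain ⟨hp, hq⟩ := hpos
  set P := A₀ ×ˢ B₁ with hP
  set Q := A₁ ×ˢ B₀ with hQ
  have hPm : MeasurableSet P := hA₀.prod hB₁
  have hQm : MeasurableSet Q := hA₁.prod hB₀
  have hPQ : Disjoint P Q := Set.disjoint_prod.2 (Or.inl hA)
  set a := γ P with ha
  set b := γ Q with hb
  have ha1 : a ≤ 1 := prob_le_one
  have hb1 : b ≤ 1 := prob_le_one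
  have hab : a * b ≠ 0 := mul_ne_zero hp hq
  have habt : a * b ≠ ∞ := ENNReal.mul_ne_top (measure_ne_top _ _) (measure_ne_top _ _)
  set γP := γ.restrict P with hγP
  set γQ := γ.restrict Q with hγQ
  set R := γ.restrict (P ∪ Q)ᶜ with hR
  have hdec : γ = R + γP + γQ := by
    rw [add_assoc, hγP, hγQ, ← Measure.restrict_union hPQ hQm, add_comm, hR,
      Measure.restrict_add_restrict_compl (hPm.union hQm)]
  set N₀ := (γP.map Prod.fst).prod (γQ.map Prod.snd) with hN₀
  set N₁ := (γQ.map Prod.fst).prod (γP.map Prod.snd) with hN₁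
  have huPf : (γP.map Prod.fst) Set.univ = a := by
    rw [Measure.map_apply measurable_fst .univ]; simp [hγP, ha]
  have huPs : (γP.map Prod.snd) Set.univ = a := by
    rw [Measure.map_apply measurable_snd .univ]; simp [hγP, ha]
  have huQf : (γQ.map Prod.fst) Set.univ = b := by
    rw [Measure.map_apply measurable_fst .univ]; simp [hγQ, hb]
  have huQs : (γQ.map Prod.snd) Set.univ = b := by
    rw [Measure.map_apply measurable_snd .univ]; simp [hγQ, hb]
  -- The products are left unnormalised: `N₀` has first marginal `b` times that of `γP` and second
  -- marginal `a` times that of `γQ`, and symmetrically for `N₁`. Removing the fraction `b` of `γP`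
  -- and `a` of `γQ` balances both marginals without division.
  set γ' := R + (1 - b) • γP + (1 - a) • γQ + N₀ + N₁ with hγ'
  have hrecombine : ∀ (c : ℝ≥0∞) (_ : c ≤ 1) (ρ : Measure X), (1 - c) • ρ + c • ρ = ρ := by
    intro c hc ρ
    rw [← add_smul, tsub_add_cancel_of_le hc, one_smul]
  have hcoup : IsCoupling γ' ν μ := by
    constructor
    · rw [← hγ.1.1]
      conv_rhs => rw [hdec]
      simp only [hγ', Measure.map_add _ _ measurable_fst, Measure.map_smul]
      rw [hN₀, hN₁, Measure.map_fst_prod, Measure.map_fst_prod, huQs, huPs]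
      conv_rhs => rw [← hrecombine b hb1 (γP.map Prod.fst), ← hrecombine a ha1 (γQ.map Prod.fst)]
      abel
    · rw [← hγ.1.2]
      conv_rhs => rw [hdec]
      simp only [hγ', Measure.map_add _ _ measurable_snd, Measure.map_smul]
      rw [hN₀, hN₁, Measure.map_snd_prod, Measure.map_snd_prod, huQf, huPf]
      conv_rhs => rw [← hrecombine b hb1 (γP.map Prod.snd), ← hrecombine a ha1 (γQ.map Prod.snd)]
      abel
  have hPae : ∀ᵐ z ∂γP, z ∈ P := ae_restrict_mem hPm
  have hQae : ∀ᵐ z ∂γQ, z ∈ Q := ae_restrict_mem hQm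
  have hPf : ∀ᵐ x ∂(γP.map Prod.fst), x ∈ A₀ :=
    (ae_map_iff measurable_fst.aemeasurable hA₀).2 (hPae.mono fun _ hz => hz.1)
  have hPs : ∀ᵐ x ∂(γP.map Prod.snd), x ∈ B₁ :=
    (ae_map_iff measurable_snd.aemeasurable hB₁).2 (hPae.mono fun _ hz => hz.2)
  have hQf : ∀ᵐ x ∂(γQ.map Prod.fst), x ∈ A₁ :=
    (ae_map_iff measurable_fst.aemeasurable hA₁).2 (hQae.mono fun _ hz => hz.1)
  have hQs : ∀ᵐ x ∂(γQ.map Prod.snd), x ∈ B₀ :=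
    (ae_map_iff measurable_snd.aemeasurable hB₀).2 (hQae.mono fun _ hz => hz.2)
  have hcP : k₀ * a ≤ transportCost γP := by
    calc k₀ * a = ∫⁻ _, k₀ ∂γP := by simp [hγP, ha]
      _ ≤ _ := lintegral_mono_ae (hPae.mono fun z hz => hk₀ _ hz.1 _ hz.2)
  have hcQ : k₁ * b ≤ transportCost γQ := by
    calc k₁ * b = ∫⁻ _, k₁ ∂γQ := by simp [hγQ, hb]
      _ ≤ _ := lintegral_mono_ae (hQae.mono fun z hz => hk₁ _ hz.1 _ hz.2)
  have hcN₀ : transportCost N₀ ≤ m₀ * (a * b) := by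
    calc transportCost N₀ ≤ ∫⁻ _, m₀ ∂N₀ := lintegral_mono_ae
          ((ae_mem_prod_of_marginals hPf hQs).mono fun z hz => hm₀ _ hz.1 _ hz.2)
      _ = m₀ * (a * b) := by
        rw [lintegral_const, hN₀, ← Set.univ_prod_univ, Measure.prod_prod, huPf, huQs]
  have hcN₁ : transportCost N₁ ≤ m₁ * (a * b) := by
    calc transportCost N₁ ≤ ∫⁻ _, m₁ ∂N₁ := lintegral_mono_ae
          ((ae_mem_prod_of_marginals hQf hPs).mono fun z hz => hm₁ _ hz.1 _ hz.2)
      _ = m₁ * (a * b) := by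
        rw [lintegral_const, hN₁, ← Set.univ_prod_univ, Measure.prod_prod, huPs, huQf, mul_comm b]
  have hopt := hγ.2 γ' hcoup
  have hcγ : transportCost γ = transportCost R + transportCost γP + transportCost γQ := by
    conv_lhs => rw [hdec]
    simp only [transportCost_add]
  have hcγ' : transportCost γ' = transportCost R + (1 - b) * transportCost γP +
      (1 - a) * transportCost γQ + transportCost N₀ + transportCost N₁ := by
    simp only [hγ', transportCost_add, transportCost_smul]
  have hsplit : ∀ (c : ℝ≥0∞) (_ : c ≤ 1) (t : ℝ≥0∞), t = (1 - c) * t + c * t := by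
    intro c hc t
    rw [← add_mul, tsub_add_cancel_of_le hc, one_mul]
  set S := transportCost R + (1 - b) * transportCost γP + (1 - a) * transportCost γQ with hS
  have hcγS : transportCost γ = S + (b * transportCost γP + a * transportCost γQ) := by
    rw [hcγ, hS]
    conv_lhs => rw [hsplit b hb1 (transportCost γP), hsplit a ha1 (transportCost γQ)]
    ring
  -- `S` is the cost of the part common to `γ` and `γ'`; it can be cancelled only because it is
  -- finite.
  have hSfin : S ≠ ∞ := ne_top_of_le_ne_top hfin (hcγS ▸ le_self_add)
  rw [hcγS, hcγ', add_assoc S, ENNReal.add_le_add_iff_left hSfin] at hopt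
  have hle : (k₀ + k₁) * (a * b) ≤ (m₀ + m₁) * (a * b) := by
    calc (k₀ + k₁) * (a * b) = b * (k₀ * a) + a * (k₁ * b) := by ring
      _ ≤ b * transportCost γP + a * transportCost γQ := by gcongr
      _ ≤ transportCost N₀ + transportCost N₁ := hopt
      _ ≤ m₀ * (a * b) + m₁ * (a * b) := add_le_add hcN₀ hcN₁
      _ = _ := by ring
  rw [ENNReal.mul_le_mul_iff_left hab habt] at hle
  exact absurd hlt hle.not_gt

end Optimality

/-! ### Distance bounds between sets -/

lemma setDist_le_dist {X : Type*} [PseudoMetricSpace X] {A B : Set X} {x y : X} (hx : x ∈ A)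
    (hy : y ∈ B) : setDist A B ≤ dist x y := by
  refine csInf_le ⟨0, ?_⟩ (Set.mem_image2_of_mem hx hy)
  rintro _ ⟨a, -, b, -, rfl⟩
  exact dist_nonneg

lemma dist_le_diam_add_diam_add_setDist {X : Type*} [PseudoMetricSpace X] {A B : Set X}
    (hA : Bornology.IsBounded A) (hB : Bornology.IsBounded B) {x y : X} (hx : x ∈ A)
    (hy : y ∈ B) : dist x y ≤ Metric.diam A + Metric.diam B + setDist A B := by
  rw [← sub_le_iff_le_add']
  refine le_csInf ⟨_, Set.mem_image2_of_mem hx hy⟩ ?_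
  rintro _ ⟨a, ha, b, hb, rfl⟩
  have h1 := Metric.dist_le_diam_of_mem hA hx ha
  have h2 := Metric.dist_le_diam_of_mem hB hb hy
  have h3 := dist_triangle4 x a b y
  linarith

lemma setDist_nonneg {X : Type*} [PseudoMetricSpace X] (A B : Set X) : 0 ≤ setDist A B := by
  -- This covers empty sets too, since `sInf ∅ = 0` in `ℝ`.
  refine Real.sInf_nonneg ?_
  rintro _ ⟨a, -, b, -, rfl⟩
  exact dist_nonneg

lemma IsOptimalPlan.transportCost_ne_top {X : Type*} [PseudoMetricSpace X] [MeasurableSpace X]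
    {γ : Measure (X × X)} {ν μ : Measure X} (hγ : IsOptimalPlan γ ν μ)
    (hW : wasserstein1 ν μ ≠ ∞) : transportCost γ ≠ ∞ :=
  ne_top_of_le_ne_top hW (le_iInf₂ hγ.2)

/-! ### Mass counting for balanced mixtures -/

section Mixture

variable {X : Type*} [MeasurableSpace X]

lemma isProbabilityMeasure_balancedMixture {ρ : Fin 2 → Measure X}
    (hρ : ∀ i, IsProbabilityMeasure (ρ i)) : IsProbabilityMeasure (balancedMixture ρ) := by
  have := hρ 0
  have := hρ 1
  constructor
  simp [balancedMixture, ENNReal.inv_two_add_inv_two]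

lemma balancedMixture_real {ρ : Fin 2 → Measure X} (hρ : ∀ i, IsProbabilityMeasure (ρ i))
    (s : Set X) : (balancedMixture ρ).real s = ((ρ 0).real s + (ρ 1).real s) / 2 := by
  have := hρ 0
  have := hρ 1
  simp only [balancedMixture, Measure.real, Measure.add_apply, Measure.smul_apply, smul_eq_mul]
  rw [ENNReal.toReal_add (by finiteness) (by finiteness)]
  simp only [ENNReal.toReal_mul, ENNReal.toReal_inv, ENNReal.toReal_ofNat]
  ring

lemma labelledLaw_real {ρ : Fin 2 → Measure X} (hρ : ∀ i, IsProbabilityMeasure (ρ i))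
    {s : Set (Fin 2 × X)} (hs : MeasurableSet s) :
    (labelledLaw ρ).real s =
      ((ρ 0).real {x | (0, x) ∈ s} + (ρ 1).real {x | (1, x) ∈ s}) / 2 := by
  have := hρ 0
  have := hρ 1
  simp only [labelledLaw, Measure.real, Measure.add_apply, Measure.smul_apply, smul_eq_mul,
    Measure.map_apply measurable_prodMk_left hs]
  rw [ENNReal.toReal_add (by finiteness) (by finiteness)]
  simp only [ENNReal.toReal_mul, ENNReal.toReal_inv, ENNReal.toReal_ofNat]
  simp only [Set.preimage]
  ring

/-- If `E` carries almost half of the mass and misses `G`, while `F` has little more than half of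
the mass and `F ∪ G` almost all of it, then little of `F` lies outside `E`. -/
lemma measureReal_inter_le_of_disjoint {n : Measure X} [IsFiniteMeasure n] {E E' F G : Set X}
    (hE' : MeasurableSet E') (hF : MeasurableSet F) (hEE' : Disjoint E E') {ε : ℝ}
    (hmass : (1 - ε) / 2 ≤ n.real E) (hFle : n.real F ≤ (1 + ε) / 2)
    (hFG : n.real (F ∪ G)ᶜ ≤ ε) (hzero : n.real (E ∩ G) = 0) :
    n.real (E' ∩ F) ≤ 2 * ε := by
  have hcover : E ⊆ (E ∩ F) ∪ (E ∩ G) ∪ (F ∪ G)ᶜ := by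
    intro x hx
    by_cases h1 : x ∈ F <;> by_cases h2 : x ∈ G <;> simp [hx, h1, h2]
  have h1 : n.real E ≤ n.real (E ∩ F) + n.real (E ∩ G) + n.real (F ∪ G)ᶜ :=
    (measureReal_mono hcover).trans <| (measureReal_union_le _ _).trans <| by
      gcongr
      exact measureReal_union_le _ _
  have h2 : n.real (E ∩ F) + n.real (E' ∩ F) ≤ n.real F := by
    rw [← measureReal_union (hEE'.mono Set.inter_subset_left Set.inter_subset_left)
      (hE'.inter hF)]
    exact measureReal_mono (by grind)
  -- `2ε` arises as `(1 + ε)/2 - ((1 - ε)/2 - ε)`.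
  linarith

/-- A transport map `T` between balanced mixtures that moves no mass between one pair of opposite
class supports transports the labels correctly up to mass `4 ε`. -/
lemma le_labelledLaw_real_of_inter_eq_zero {μ ν : Fin 2 → Measure X}
    (hμ : ∀ i, IsProbabilityMeasure (μ i)) (hν : ∀ i, IsProbabilityMeasure (ν i)) {ε : ℝ}
    {Eμ Eν : Fin 2 → Set X} (hEμ_meas : ∀ i, MeasurableSet (Eμ i))
    (hEν_meas : ∀ i, MeasurableSet (Eν i))
    (hEμ_disj : Disjoint (Eμ 0) (Eμ 1)) (hEν_disj : Disjoint (Eν 0) (Eν 1))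
    (hEμ_mass : ∀ i, 1 - ε ≤ (μ i).real (Eμ i)) (hEν_mass : ∀ i, 1 - ε ≤ (ν i).real (Eν i))
    {h : X → Fin 2} (hh_meas : Measurable h) (hh : ∀ i, ∀ y ∈ Eμ i, h y = i)
    {T : X → X} (hT : Measurable T) (hmap : (balancedMixture ν).map T = balancedMixture μ)
    (hzero : (balancedMixture ν).real (Eν 0 ∩ T ⁻¹' Eμ 1) = 0 ∨
      (balancedMixture ν).real (Eν 1 ∩ T ⁻¹' Eμ 0) = 0) :
    1 - 4 * ε ≤ (labelledLaw ν).real {s | h (T s.2) = s.1} := by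
  have := isProbabilityMeasure_balancedMixture hν
  have := isProbabilityMeasure_balancedMixture hμ
  have := hμ 0
  have := hμ 1
  have := hν 0
  have := hν 1
  set n := balancedMixture ν with hn
  have hF : ∀ i, MeasurableSet (T ⁻¹' Eμ i) := fun i => hT (hEμ_meas i)
  have hpush : ∀ s, MeasurableSet s → n.real (T ⁻¹' s) = ((μ 0).real s + (μ 1).real s) / 2 := by
    intro s hs
    rw [← map_measureReal_apply hT hs, hmap, balancedMixture_real hμ]
  have hμ01 : (μ 0).real (Eμ 0) + (μ 0).real (Eμ 1) ≤ 1 := by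
    rw [← measureReal_union hEμ_disj (hEμ_meas 1)]; exact measureReal_le_one
  have hμ11 : (μ 1).real (Eμ 0) + (μ 1).real (Eμ 1) ≤ 1 := by
    rw [← measureReal_union hEμ_disj (hEμ_meas 1)]; exact measureReal_le_one
  have hout : n.real (T ⁻¹' Eμ 0 ∪ T ⁻¹' Eμ 1)ᶜ ≤ ε := by
    rw [← Set.preimage_union, ← Set.preimage_compl,
      hpush _ ((hEμ_meas 0).union (hEμ_meas 1)).compl,
      probReal_compl_eq_one_sub ((hEμ_meas 0).union (hEμ_meas 1)),
      probReal_compl_eq_one_sub ((hEμ_meas 0).union (hEμ_meas 1)),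
      measureReal_union hEμ_disj (hEμ_meas 1), measureReal_union hEμ_disj (hEμ_meas 1)]
    linarith [hEμ_mass 0, hEμ_mass 1, measureReal_nonneg (μ := μ 0) (s := Eμ 1),
      measureReal_nonneg (μ := μ 1) (s := Eμ 0)]
  have hF0 : n.real (T ⁻¹' Eμ 0) ≤ (1 + ε) / 2 := by
    rw [hpush _ (hEμ_meas 0)]
    linarith [hEμ_mass 1, measureReal_nonneg (μ := μ 0) (s := Eμ 1)]
  have hF1 : n.real (T ⁻¹' Eμ 1) ≤ (1 + ε) / 2 := by
    rw [hpush _ (hEμ_meas 1)]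
    linarith [hEμ_mass 0, measureReal_nonneg (μ := μ 1) (s := Eμ 0)]
  have hE0 : (1 - ε) / 2 ≤ n.real (Eν 0) := by
    rw [hn, balancedMixture_real hν]
    linarith [hEν_mass 0, measureReal_nonneg (μ := ν 1) (s := Eν 0)]
  have hE1 : (1 - ε) / 2 ≤ n.real (Eν 1) := by
    rw [hn, balancedMixture_real hν]
    linarith [hEν_mass 1, measureReal_nonneg (μ := ν 0) (s := Eν 1)]
  have hswap : n.real (Eν 0 ∩ T ⁻¹' Eμ 1) + n.real (Eν 1 ∩ T ⁻¹' Eμ 0) ≤ 2 * ε := by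
    rcases hzero with h0 | h0
    · rw [h0, zero_add]
      exact measureReal_inter_le_of_disjoint (hEν_meas 1) (hF 0) hEν_disj hE0 hF0 hout h0
    · rw [h0, add_zero]
      exact measureReal_inter_le_of_disjoint (hEν_meas 0) (hF 1) hEν_disj.symm hE1 hF1
        (by rwa [Set.union_comm]) h0
  -- Union bound: a point of class `i` is labelled correctly unless it lies outside `Eν i`, or its
  -- image lies in the opposite `Eμ j` or outside both source sets.
  have hwrong : ∀ i j, (∀ k : Fin 2, k = i ∨ k = j) → 1 ≤ (ν i).real {x | h (T x) = i} + ε +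
      (ν i).real (Eν i ∩ T ⁻¹' Eμ j) + (ν i).real (T ⁻¹' Eμ 0 ∪ T ⁻¹' Eμ 1)ᶜ := by
    intro i j hij
    have := hν i
    have hcover : Set.univ ⊆ {x | h (T x) = i} ∪ (Eν i)ᶜ ∪ (Eν i ∩ T ⁻¹' Eμ j) ∪
        (T ⁻¹' Eμ 0 ∪ T ⁻¹' Eμ 1)ᶜ := by
      intro x _
      by_cases hx : x ∈ Eν i
      · by_cases hTx : ∃ k, T x ∈ Eμ k
        · obtain ⟨k, hk⟩ := hTx
          rcases hij k with rfl | rfl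
          · exact Or.inl (Or.inl (Or.inl (hh _ _ hk)))
          · exact Or.inl (Or.inr ⟨hx, hk⟩)
        · refine Or.inr fun hx' => hTx ?_
          exact hx'.elim (fun h0 => ⟨0, h0⟩) (fun h1 => ⟨1, h1⟩)
      · exact Or.inl (Or.inl (Or.inr hx))
    have h1 := measureReal_mono (μ := ν i) hcover
    rw [probReal_univ] at h1
    have h2 := measureReal_union_le (μ := ν i)
      ({x | h (T x) = i} ∪ (Eν i)ᶜ ∪ (Eν i ∩ T ⁻¹' Eμ j)) (T ⁻¹' Eμ 0 ∪ T ⁻¹' Eμ 1)ᶜ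
    have h3 := measureReal_union_le (μ := ν i) ({x | h (T x) = i} ∪ (Eν i)ᶜ)
      (Eν i ∩ T ⁻¹' Eμ j)
    have h4 := measureReal_union_le (μ := ν i) {x | h (T x) = i} (Eν i)ᶜ
    rw [probReal_compl_eq_one_sub (hEν_meas i)] at h4
    linarith [hEν_mass i]
  have hw0 := hwrong 0 1 (by decide)
  have hw1 := hwrong 1 0 (by decide)
  rw [labelledLaw_real hν (measurableSet_eq_fun (by fun_prop) (by fun_prop))]
  rw [hn, balancedMixture_real hν] at hout
  rw [hn, balancedMixture_real hν, balancedMixture_real hν] at hswap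
  simp only [Set.mem_ofPred_eq]
  -- Averaging the two class bounds gives the loss `ε + 2ε + ε`; the listed cross terms of `hswap`
  -- are dropped as nonnegative.
  linarith [measureReal_nonneg (μ := ν 1) (s := Eν 0 ∩ T ⁻¹' Eμ 1),
    measureReal_nonneg (μ := ν 0) (s := Eν 1 ∩ T ⁻¹' Eμ 0)]

end Mixture

/-! ### Conclusion for optimal transport maps -/

theorem theorem4 {d : ℕ}
    (μ ν : Fin 2 → Measure (EuclideanSpace ℝ (Fin d)))
    (hμ : ∀ i, IsProbabilityMeasure (μ i)) (hν : ∀ i, IsProbabilityMeasure (ν i))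
    (ε : ℝ) (hε : 0 < ε)
    (Eμ Eν : Fin 2 → Set (EuclideanSpace ℝ (Fin d)))
    (hEμ_meas : ∀ i, MeasurableSet (Eμ i)) (hEν_meas : ∀ i, MeasurableSet (Eν i))
    (hEμ_bdd : ∀ i, Bornology.IsBounded (Eμ i)) (hEν_bdd : ∀ i, Bornology.IsBounded (Eν i))
    (hEμ_disj : Disjoint (Eμ 0) (Eμ 1)) (hEν_disj : Disjoint (Eν 0) (Eν 1))
    (hEμ_mass : ∀ i, 1 - ε ≤ (μ i).real (Eμ i))
    (hEν_mass : ∀ i, 1 - ε ≤ (ν i).real (Eν i))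
    (hsep : (Metric.diam (Eμ 0) + Metric.diam (Eν 0) + setDist (Eμ 0) (Eν 0)) +
        (Metric.diam (Eμ 1) + Metric.diam (Eν 1) + setDist (Eμ 1) (Eν 1)) <
      setDist (Eμ 0) (Eν 1) + setDist (Eμ 1) (Eν 0))
    (hW : wasserstein1 (balancedMixture ν) (balancedMixture μ) ≠ ∞)
    (h : EuclideanSpace ℝ (Fin d) → Fin 2) (hh_meas : Measurable h)
    (hh : ∀ i, ∀ y ∈ Eμ i, h y = i)
    (T : EuclideanSpace ℝ (Fin d) → EuclideanSpace ℝ (Fin d))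
    (hT : IsOptimalTransportMap T (balancedMixture ν) (balancedMixture μ)) :
    1 - 7 * ε < (labelledLaw ν).real {s | h (T s.2) = s.1} := by
  have := isProbabilityMeasure_balancedMixture hν
  obtain ⟨hTm, hopt⟩ := hT
  have hgraph : Measurable fun x => (x, T x) := measurable_id.prodMk hTm
  have hmap : (balancedMixture ν).map T = balancedMixture μ := by
    rw [← hopt.1.2, Measure.map_map measurable_snd hgraph]
    rfl
  have : IsProbabilityMeasure ((balancedMixture ν).map fun x => (x, T x)) :=
    Measure.isProbabilityMeasure_map hgraph.aemeasurable
  have hnn : ∀ i, 0 ≤ Metric.diam (Eμ i) + Metric.diam (Eν i) + setDist (Eμ i) (Eν i) :=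
    fun i => add_nonneg (add_nonneg Metric.diam_nonneg Metric.diam_nonneg) (setDist_nonneg _ _)
  have hfar : ∀ i j, ∀ x ∈ Eν i, ∀ y ∈ Eμ j,
      ENNReal.ofReal (setDist (Eμ j) (Eν i)) ≤ edist x y := by
    intro i j x hx y hy
    rw [edist_dist, dist_comm]
    exact ENNReal.ofReal_le_ofReal (setDist_le_dist hy hx)
  have hnear : ∀ i, ∀ x ∈ Eν i, ∀ y ∈ Eμ i, edist x y ≤
      ENNReal.ofReal (Metric.diam (Eμ i) + Metric.diam (Eν i) + setDist (Eμ i) (Eν i)) := by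
    intro i x hx y hy
    rw [edist_dist, dist_comm]
    exact ENNReal.ofReal_le_ofReal
      (dist_le_diam_add_diam_add_setDist (hEμ_bdd i) (hEν_bdd i) hy hx)
  have hzero := hopt.measure_prod_eq_zero_or (hopt.transportCost_ne_top hW) (hEν_meas 0)
    (hEν_meas 1) (hEμ_meas 0) (hEμ_meas 1) hEν_disj (hfar 0 1) (hfar 1 0) (hnear 0) (hnear 1) (by
      rw [← ENNReal.ofReal_add (hnn 0) (hnn 1),
        ← ENNReal.ofReal_add (setDist_nonneg _ _) (setDist_nonneg _ _),
        ENNReal.ofReal_lt_ofReal_iff_of_nonneg (add_nonneg (hnn 0) (hnn 1))]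
      linarith)
  rw [Measure.map_apply hgraph ((hEν_meas 0).prod (hEμ_meas 1)),
    Measure.map_apply hgraph ((hEν_meas 1).prod (hEμ_meas 0))] at hzero
  have hle := le_labelledLaw_real_of_inter_eq_zero hμ hν hEμ_meas hEν_meas hEμ_disj hEν_disj
    hEμ_mass hEν_mass hh_meas hh hTm hmap
    (hzero.imp (fun h0 => (measureReal_eq_zero_iff).2 h0)
      (fun h0 => (measureReal_eq_zero_iff).2 h0))
  linarith
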